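/- Let $m\ge 1$ and $n\ge 0$ be integers. An $m$-ballot path of size $n$ is a lattice path from $(0,0)$ to $(mn,n)$ with up steps $1=(0,1)$ and down steps $0=(1,0)$ all of whose points $(x,y)$ satisfy $x\le my$. It is primitive if it is nonempty and meets the line $x=my$ only at its two ends. A rotation of a path exchanges a down step that is followed by a (translated) primitive path $c$ with $c$. The $m$-Tamari lattice $\mathcal{T}_n^{(m)}$ is the set of $m$-ballot paths of size $n$, ordered by $D\le D'$ if $D'$ is obtained from $D$ by a (possibly empty) sequence of rotations. The number of returns to $0$ of a path is its number of contacts with the line $x=my$ after the origin. An $(m+1)$-ary tree is either empty or a root node with $m+1$ ordered subtrees $T_L,T_{R_1},\dots,T_{R_m}$. The path $D(T)$ of a tree is defined by letting $D(\emptyset)$ be the empty path and $D(T)=D(T_L)\,1\,D(T_{R_m})\,0\,D(T_{R_{m-1}})\,0\cdots D(T_{R_1})\,0$; an $(m+1)$-ary tree with $n$ nodes is thereby identified with an $m$-ballot path of size $n$, and $T'\le T$ means $D(T')\le D(T)$ in $\mathcal{T}_n^{(m)}$. The left branch of a nonempty tree consists of its root and the left branch of $T_L$ (the left branch of the empty tree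 is empty). For polynomials in $x,y$ put $\Delta(g)=\dfrac{x\,g(x,y)-g(1,y)}{x-1}$ and $$B^{(m)}(f,g_1,\dots,g_m)=f\,x\,y\,\Delta(g_1\Delta(g_2\Delta(\cdots\Delta(g_m))\cdots)).$$ For an $(m+1)$-ary tree $T$ define $\mathcal{B}_T^{(m)}\in\mathbb{Z}[x]$ recursively by $\mathcal{B}_\emptyset^{(m)}=1$ and, for nonempty $T$, $$\mathcal{B}_T^{(m)}=B^{(m)}\bigl(\mathcal{B}_{T_L}^{(m)},\mathcal{B}_{T_{R_1}}^{(m)},\dots,\mathcal{B}_{T_{R_m}}^{(m)}\bigr)\Big|_{y=1}.$$ **Theorem.** Let $T$ be an $(m+1)$-ary tree with $n$ nodes. Then $\mathcal{B}_T^{(m)}$ counts the elements of $\mathcal{T}_n^{(m)}$ that are smaller than or equal to $T$ according to the number of nodes on their left branch or, equivalently, according to the number of returns to $0$ of their paths: $$\mathcal{B}_T^{(m)}(x)=\sum_{T'\le T}x^{\,\#\{\text{nodes on the left branch of }T'\}}=\sum_{D\le D(T)}x^{\,\#\{\text{returns to }0\text{ of }D\}},$$ where $T'$ runs over the $(m+1)$-ary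 trees with $n$ nodes and $D$ over the $m$-ballot paths of size $n$, and for every $(m+1)$-ary tree $T'$ with $n$ nodes the number of nodes on its left branch equals the number of returns to $0$ of $D(T')$. In particular, $\mathcal{B}_T^{(m)}(1)$ is the number of elements smaller than or equal to $T$. -/

import Mathlib

open Polynomial

namespace MTamari

/-! ## `m`-ballot paths and the `m`-Tamari order

A path is a word on `Bool`: `true` is the vertical (up) step `(0, 1)` and `false` is the horizontal
(down) step `(1, 0)`. -/

/-- `w` is an `m`-ballot path of size `n`: it goes from `(0, 0)` to `(m n, n)` and every point
`(x, y)` on it satisfies `x ≤ m y`. -/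
def IsBallot (m n : ℕ) (w : List Bool) : Prop :=
  w.count true = n ∧ w.count false = m * n ∧
    ∀ p, p <+: w → p.count false ≤ m * p.count true

/-- A nonempty ballot path which meets the line `x = m y` only at its two ends. -/
def IsPrimitive (m : ℕ) (c : List Bool) : Prop :=
  (∃ k, IsBallot m k c) ∧ c ≠ [] ∧
    ∀ p, p <+: c → p ≠ [] → p ≠ c → p.count false ≠ m * p.count true

/-- The `m`-ballot paths of size `n`. -/
def BallotPath (m n : ℕ) : Type := {w : List Bool // IsBallot m n w}

/-- `v` is obtained from `u` by a rotation: a down step of `u` which is followed by a primitive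
path `c` is exchanged with `c`. -/
def Rotation {m n : ℕ} (u v : BallotPath m n) : Prop :=
  ∃ a c b : List Bool, IsPrimitive m c ∧
    u.1 = a ++ false :: (c ++ b) ∧ v.1 = a ++ (c ++ false :: b)

/-- The number of returns to `0`: contacts with the line `x = m y` after the origin. -/
def BallotPath.returns {m n : ℕ} (D : BallotPath m n) : ℕ :=
  ((Finset.Icc 1 D.1.length).filter fun k =>
    (D.1.take k).count false = m * (D.1.take k).count true).card

theorem Rotation.lt {m n : ℕ} {u v : BallotPath m n} (h : Rotation u v) : u.1 < v.1 := by
  obtain ⟨a, c, b, ⟨⟨k, hk⟩, hc, -⟩, hu, hv⟩ := h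
  rw [hu, hv]
  apply List.append_left_lt
  cases c with
  | nil => exact absurd rfl hc
  | cons x c =>
    cases x with
    | true => exact List.Lex.rel (by decide)
    | false =>
      have := hk.2.2 [false] (by simp)
      simp at this

/-- The `m`-Tamari order: `u ≤ v` if `v` is reached from `u` by a sequence of rotations. -/
instance (m n : ℕ) : PartialOrder (BallotPath m n) where
  le := Relation.ReflTransGen Rotation
  le_refl _ := Relation.ReflTransGen.refl
  le_trans _ _ _ := Relation.ReflTransGen.trans
  le_antisymm u v huv hvu := by
    have key : ∀ {a b : BallotPath m n}, Relation.ReflTransGen Rotation a b → a.1 ≤ b.1 := by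
      intro a b h
      induction h with
      | refl => exact le_rfl
      | tail _ h ih => exact ih.trans h.lt.le
    exact Subtype.ext (le_antisymm (key huv) (key hvu))

/-! ## `(m+1)`-ary trees -/

/-- `(m+1)`-ary trees: the empty tree, or a root with `m + 1` ordered subtrees, the leftmost one
`T_L` having index `0` and the others `T_{R_1}, …, T_{R_m}` having indices `1, …, m`. -/
inductive Tree (m : ℕ) : Type
  | empty : Tree m
  | node : (Fin (m + 1) → Tree m) → Tree m

/-- The number of nodes. -/
def Tree.size {m : ℕ} : Tree m → ℕ
  | .empty => 0
  | .node f => 1 + ∑ i, (f i).size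

/-- The number of nodes on the left branch. -/
def Tree.leftBranch {m : ℕ} : Tree m → ℕ
  | .empty => 0
  | .node f => 1 + (f 0).leftBranch

/-- The word of the path of a tree: `D = D_L 1 D_{R_m} 0 D_{R_{m-1}} 0 … D_{R_1} 0`. -/
def Tree.word {m : ℕ} : Tree m → List Bool
  | .empty => []
  | .node f => (f 0).word ++
      true :: (List.ofFn fun i : Fin m => (f i.succ).word ++ [false]).reverse.flatten

theorem count_blocks {m : ℕ} (L : List (List Bool))
    (h : ∀ w ∈ L, w.count false = m * w.count true) :
    (L.map (· ++ [false])).flatten.count false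
      = m * (L.map (· ++ [false])).flatten.count true + L.length := by
  induction L with
  | nil => simp
  | cons w L ih =>
    have h1 := ih fun w hw => h w (by simp [hw])
    have h2 := h w (by simp)
    simp only [List.map_cons, List.flatten_cons, List.count_append, List.length_cons, h1, h2]
    simp
    ring

theorem prefix_blocks {m : ℕ} (L : List (List Bool))
    (h : ∀ w ∈ L, w.count false = m * w.count true ∧
      ∀ p, p <+: w → p.count false ≤ m * p.count true)
    (p : List Bool) (hp : p <+: (L.map (· ++ [false])).flatten)
    (hne : p ≠ (L.map (· ++ [false])).flatten) :
    p.count false < m * p.count true + L.length := by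
  induction L generalizing p with
  | nil => simp at hp hne; exact absurd hp hne
  | cons w L ih =>
    have h2 := h w (by simp)
    simp only [List.map_cons, List.flatten_cons, List.append_assoc, List.singleton_append] at hp hne
    rcases List.prefix_or_prefix_of_prefix hp (List.prefix_append w _) with hw | ⟨q, rfl⟩
    · have := h2.2 p hw
      simp; omega
    · rw [List.prefix_append_right_inj] at hp
      cases q with
      | nil => simp; omega
      | cons x q =>
        rw [List.cons_prefix_cons] at hp
        obtain ⟨rfl, hq⟩ := hp
        have := ih (fun w hw => h w (by simp [hw])) q hq (by rintro rfl; exact hne rfl)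
        simp [mul_add]; omega

theorem blocks_injective {m : ℕ} (L L' : List (List Bool)) (hl : L.length = L'.length)
    (h : ∀ w ∈ L, w.count false = m * w.count true ∧
      ∀ p, p <+: w → p.count false ≤ m * p.count true)
    (h' : ∀ w ∈ L', w.count false = m * w.count true ∧
      ∀ p, p <+: w → p.count false ≤ m * p.count true)
    (e : (L.map (· ++ [false])).flatten = (L'.map (· ++ [false])).flatten) : L = L' := by
  have key : ∀ (w v s t : List Bool), w.count false = m * w.count true →
      (∀ p, p <+: v → p.count false ≤ m * p.count true) →
      w ++ false :: s = v ++ false :: t → v <+: w := by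
    intro w v s t hw hv e
    rcases List.prefix_or_prefix_of_prefix (List.prefix_append w (false :: s))
      (e ▸ List.prefix_append v (false :: t)) with ⟨q, rfl⟩ | hh
    · cases q with
      | nil => simp
      | cons x q =>
        simp only [List.append_assoc, List.append_cancel_left_eq, List.cons_append,
          List.cons.injEq] at e
        obtain ⟨rfl, -⟩ := e
        have := hv (w ++ [false]) ⟨q, by simp⟩
        simp at this; omega
    · exact hh
  induction L generalizing L' with
  | nil => cases L' with
    | nil => rfl
    | cons => simp at hl
  | cons w L ih => cases L' with
    | nil => simp at hl
    | cons v L' =>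
      have hw := h w (by simp)
      have hv := h' v (by simp)
      simp only [List.map_cons, List.flatten_cons, List.append_assoc, List.singleton_append] at e
      have : w = v := by
        have h1 := key w v _ _ hw.1 hv.2 e
        have h2 := key v w _ _ hv.1 hw.2 e.symm
        exact h2.eq_of_length_le h1.length_le
      subst this
      simp only [List.append_cancel_left_eq, List.cons.injEq, true_and] at e
      rw [ih L' (by simpa using hl) (fun w hw => h w (by simp [hw]))
        (fun w hw => h' w (by simp [hw])) e]

/-- The words of the right subtrees, from the last one to the first one. -/
def Tree.rights {m : ℕ} (f : Fin (m + 1) → Tree m) : List (List Bool) :=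
  (List.ofFn fun i : Fin m => (f i.succ).word).reverse

theorem Tree.word_node {m : ℕ} (f : Fin (m + 1) → Tree m) :
    (Tree.node f).word =
      (f 0).word ++ true :: ((Tree.rights f).map (· ++ [false])).flatten := by
  rw [Tree.word, Tree.rights, List.map_reverse, List.map_ofFn]; rfl

theorem Tree.word_count_true {m : ℕ} (T : Tree m) : T.word.count true = T.size := by
  induction T with
  | empty => rfl
  | node f ih =>
    rw [Tree.word, Tree.size, Fin.sum_univ_succ]
    simp only [List.count_append, List.count_cons, List.count_flatten, List.map_reverse,
      List.sum_reverse, List.map_ofFn, List.sum_ofFn, ih]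
    simp [ih]; ring

theorem Tree.word_balanced {m : ℕ} (T : Tree m) :
    T.word.count false = m * T.word.count true ∧
      ∀ p, p <+: T.word → p.count false ≤ m * p.count true := by
  induction T with
  | empty => simp [Tree.word]
  | node f ih =>
    have hr : ∀ w ∈ Tree.rights f, w.count false = m * w.count true ∧
        ∀ p, p <+: w → p.count false ≤ m * p.count true := by
      intro w hw
      simp only [Tree.rights, List.mem_reverse, List.mem_ofFn] at hw
      obtain ⟨i, rfl⟩ := hw
      exact ih _
    have hlen : (Tree.rights f).length = m := by simp [Tree.rights]
    have hc := count_blocks _ fun w hw => (hr w hw).1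
    have h0 := ih 0
    rw [Tree.word_node]
    refine ⟨?_, fun p hp => ?_⟩
    · simp only [List.count_append, List.count_cons, h0.1, hc, hlen]
      simp; ring
    · rcases List.prefix_or_prefix_of_prefix hp (List.prefix_append (f 0).word _) with hw | ⟨q, rfl⟩
      · exact h0.2 p hw
      · rw [List.prefix_append_right_inj] at hp
        cases q with
        | nil => simp [h0.1]
        | cons x q =>
          rw [List.cons_prefix_cons] at hp
          obtain ⟨rfl, hq⟩ := hp
          have : q.count false ≤ m * q.count true + m := by
            by_cases hne : q = ((Tree.rights f).map (· ++ [false])).flatten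
            · rw [hne, hc, hlen]
            · have := prefix_blocks _ hr q hq hne
              omega
          simp [mul_add, h0.1]; omega

theorem Tree.word_injective {m : ℕ} : Function.Injective (Tree.word (m := m)) := by
  have key : ∀ f g : Fin (m + 1) → Tree m, (Tree.node f).word = (Tree.node g).word →
      (g 0).word <+: (f 0).word := by
    intro f g e
    rw [Tree.word_node, Tree.word_node] at e
    rcases List.prefix_or_prefix_of_prefix (List.prefix_append (f 0).word _)
      (e ▸ List.prefix_append (g 0).word _) with ⟨q, hq⟩ | hh
    · cases q with
      | nil => simp [← hq]
      | cons x q =>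
        rw [← hq] at e
        simp only [List.append_assoc, List.append_cancel_left_eq, List.cons_append,
          List.cons.injEq] at e
        obtain ⟨rfl, e⟩ := e
        have h1 := prefix_blocks (m := m) (Tree.rights f) (by
          intro w hw
          simp only [Tree.rights, List.mem_reverse, List.mem_ofFn] at hw
          obtain ⟨i, rfl⟩ := hw
          exact Tree.word_balanced _) q ⟨_, e.symm⟩ (by intro h; rw [h] at e; simp at e)
        have h2 := (Tree.word_balanced (g 0)).1
        have h3 := (Tree.word_balanced (f 0)).1
        have hlen : (Tree.rights f).length = m := by simp [Tree.rights]
        rw [← hq] at h2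
        simp [mul_add] at h2
        omega
    · exact hh
  intro S T e
  induction S generalizing T with
  | empty => cases T with
    | empty => rfl
    | node g => simp [Tree.word] at e
  | node f ih => cases T with
    | empty => simp [Tree.word] at e
    | node g =>
      have h0 : (f 0).word = (g 0).word :=
        (key g f e.symm).eq_of_length_le (key f g e).length_le
      rw [Tree.word_node, Tree.word_node, h0] at e
      simp only [List.append_cancel_left_eq, List.cons.injEq, true_and] at e
      have hr : ∀ f : Fin (m + 1) → Tree m, ∀ w ∈ Tree.rights f,
          w.count false = m * w.count true ∧
            ∀ p, p <+: w → p.count false ≤ m * p.count true := by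
        intro f w hw
        simp only [Tree.rights, List.mem_reverse, List.mem_ofFn] at hw
        obtain ⟨i, rfl⟩ := hw
        exact Tree.word_balanced _
      have := blocks_injective _ _ (by simp [Tree.rights]) (hr f) (hr g) e
      rw [Tree.rights, Tree.rights, List.reverse_inj, List.ofFn_inj] at this
      congr 1
      funext i
      refine Fin.cases ?_ (fun i => ?_) i
      · exact ih 0 h0
      · exact ih i.succ (congrFun this i)

/-- The `(m+1)`-ary trees with `n` nodes. -/
def SizedTree (m n : ℕ) : Type := {T : Tree m // T.size = n}

/-- The `m`-ballot path of size `n` corresponding to an `(m+1)`-ary tree with `n` nodes. -/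
def SizedTree.toPath {m n : ℕ} (T : SizedTree m n) : BallotPath m n :=
  ⟨T.1.word, by
    have h := T.1.word_balanced
    rw [T.1.word_count_true, T.2] at h
    exact ⟨T.1.word_count_true.trans T.2, h.1, h.2⟩⟩

theorem SizedTree.toPath_injective {m n : ℕ} :
    Function.Injective (SizedTree.toPath (m := m) (n := n)) := fun _ _ h =>
  Subtype.ext (Tree.word_injective (congrArg Subtype.val h))

/-- The `m`-Tamari order on `(m+1)`-ary trees, carried over from paths. -/
instance (m n : ℕ) : PartialOrder (SizedTree m n) :=
  PartialOrder.lift SizedTree.toPath SizedTree.toPath_injective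

instance (m n : ℕ) : Finite (BallotPath m n) := by
  have h : Set.Finite {w : List Bool | IsBallot m n w} := by
    refine (List.finite_length_eq Bool (n + m * n)).subset fun w hw => ?_
    have := List.count_true_add_count_false w
    have h1 := hw.1
    have h2 := hw.2.1
    change w.length = n + m * n; omega
  exact h.to_subtype

instance (m n : ℕ) : Finite (SizedTree m n) :=
  Finite.of_injective _ SizedTree.toPath_injective

noncomputable instance (m n : ℕ) : Fintype (BallotPath m n) := Fintype.ofFinite _

noncomputable instance (m n : ℕ) : Fintype (SizedTree m n) := Fintype.ofFinite _

noncomputable instance (m n : ℕ) : DecidableLE (BallotPath m n) := Classical.decRel _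

noncomputable instance (m n : ℕ) : DecidableLE (SizedTree m n) := Classical.decRel _

/-! ## The polynomials

A polynomial in `x, y` is an element of `ℤ[X][X]`, where the outer variable is `x` and the inner
one is `y`. -/

/-- The divided difference `Δ(g) = (x g(x, y) - g(1, y)) / (x - 1)`. -/
noncomputable def Δ (g : ℤ[X][X]) : ℤ[X][X] := (X * g - C (g.eval 1)) /ₘ (X - C 1)

/-- The division in `Δ` is exact. -/
theorem Δ_spec (g : ℤ[X][X]) : (X - 1) * Δ g = X * g - C (g.eval 1) := by
  have := (Polynomial.mul_divByMonic_eq_iff_isRoot (a := (1 : ℤ[X]))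
    (p := X * g - C (g.eval 1))).2 (by simp [IsRoot])
  simpa [Δ] using this

/-- `B^{(m)}(f, g_1, …, g_m) = f x y Δ(g_1 Δ(g_2 Δ(⋯ Δ(g_m))⋯))`. -/
noncomputable def B {m : ℕ} (f : ℤ[X][X]) (g : Fin m → ℤ[X][X]) : ℤ[X][X] :=
  f * X * C X * (List.ofFn g).foldr (fun h acc => Δ (h * acc)) 1

/-- A polynomial in `x` as a polynomial in `x, y`. -/
noncomputable def toXY : ℤ[X] →+* ℤ[X][X] := mapRingHom C

/-- The substitution `y = 1`. -/
noncomputable def atYOne : ℤ[X][X] →+* ℤ[X] := mapRingHom (evalRingHom 1)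

/-- The polynomial `𝓑_T^{(m)}(x)`: it is `1` for the empty tree, and
`B^{(m)}(𝓑_{T_L}, 𝓑_{T_{R_1}}, …, 𝓑_{T_{R_m}})` at `y = 1` otherwise. -/
noncomputable def Tree.poly {m : ℕ} : Tree m → ℤ[X]
  | .empty => 1
  | .node f => atYOne (B (toXY (f 0).poly) fun i : Fin m => toXY (f i.succ).poly)

end MTamari

/-!
An up step raises the level of a word by `m` and a down step lowers it by `1`. Rotations preserve
the words that end at their lowest level, ballot words being those that end at level `0`.
Weigh such a word by `x` to the number of its contacts, that is, of its points before the end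
that lie at the final level; on ballot words these are the returns to `0`. The word of a tree is
built by three operations, each of which has a transparent effect on the words below.

* Below `u v`, with `v` a ballot word, lie the products of a word below `u` and a word below `v`,
  and the contacts add up.
* Below `1 u` lie the words `1 u'` with `u'` below `u`; such a word has one contact more than `u'`.
* Below `u 0` lie the words `s 0 v` with `s v` below `u` and `v` a ballot word. The contacts of
  `s 0 v` are those of `v`, and the ballot suffixes `v` of a word with `r` contacts have
  `0, 1, …, r` contacts, so `x ^ r` becomes `1 + x + ⋯ + x ^ r = Δ(x ^ r)`.
-/

namespace MTamari

variable {m n : ℕ} {k : ℤ} {u v w : List Bool}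

/-! ## Levels of words -/

/-- The level reached by a word: an up step counts for `m`, a down step for `-1`. The point
`(x, y)` of a path has level `m y - x`, so that level `0` is the line `x = m y`. -/
def level (m : ℕ) (w : List Bool) : ℤ := m * w.count true - w.count false

@[simp] theorem level_nil : level m [] = 0 := by simp [level]

@[simp] theorem level_append : level m (u ++ v) = level m u + level m v := by
  simp only [level, List.count_append, Nat.cast_add]; ring

@[simp] theorem level_cons_true : level m (true :: w) = m + level m w := by
  rw [← List.singleton_append, level_append]; simp [level]

@[simp] theorem level_cons_false : level m (false :: w) = -1 + level m w := by
  rw [← List.singleton_append, level_append]; simp [level]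

theorem level_nonneg_iff : 0 ≤ level m w ↔ w.count false ≤ m * w.count true := by
  rw [level]; zify; omega

theorem level_eq_zero_iff : level m w = 0 ↔ w.count false = m * w.count true := by
  rw [level]; zify; omega

theorem level_eq_of_perm (h : u.Perm v) : level m u = level m v := by
  simp only [level, h.count_eq]

theorem level_take_add_level_drop (w : List Bool) (i : ℕ) :
    level m (w.take i) + level m (w.drop i) = level m w := by
  rw [← level_append, List.take_append_drop]

/-- Every point of the word `w` has level at least `k`. -/
def Above (m : ℕ) (k : ℤ) (w : List Bool) : Prop := ∀ p, p <+: w → k ≤ level m p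

theorem Above.mono {l : ℤ} (h : Above m l w) (hk : k ≤ l) : Above m k w :=
  fun p hp => hk.trans (h p hp)

theorem Above.le_level (h : Above m k w) : k ≤ level m w := h w List.prefix_rfl

theorem Above.nonpos (h : Above m k w) : k ≤ 0 := by simpa using h [] List.nil_prefix

@[simp] theorem above_nil : Above m k [] ↔ k ≤ 0 := by simp [Above]

theorem above_cons {a : Bool} :
    Above m k (a :: w) ↔ k ≤ 0 ∧ ∀ p, p <+: w → k ≤ level m (a :: p) := by
  refine ⟨fun h => ⟨h.nonpos, fun p hp => h _ ((List.prefix_cons_inj a).2 hp)⟩, ?_⟩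
  rintro ⟨hk, h⟩ p hp
  rcases List.prefix_cons_iff.1 hp with rfl | ⟨q, rfl, hq⟩
  · simpa using hk
  · exact h q hq

@[simp] theorem above_cons_true : Above m k (true :: w) ↔ k ≤ 0 ∧ Above m (k - m) w := by
  rw [above_cons]
  simp only [Above, level_cons_true, sub_le_iff_le_add']

@[simp] theorem above_cons_false : Above m k (false :: w) ↔ k ≤ 0 ∧ Above m (k + 1) w := by
  rw [above_cons]
  simp only [Above, level_cons_false, le_neg_add_iff_add_le, add_comm k 1]

@[simp] theorem above_append :
    Above m k (u ++ v) ↔ Above m k u ∧ Above m (k - level m u) v := by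
  induction u generalizing k with
  | nil => simpa using Above.nonpos
  | cons a u ih => cases a <;> simp [ih, and_assoc, sub_add_eq_sub_sub]

/-- The word `w` ends at level `k`, and `k` is its lowest level. -/
def Descends (m : ℕ) (k : ℤ) (w : List Bool) : Prop := level m w = k ∧ Above m k w

theorem isBallot_iff : IsBallot m n w ↔ w.count true = n ∧ Descends m 0 w := by
  simp only [IsBallot, Descends, Above, level_nonneg_iff, level_eq_zero_iff]
  exact and_congr_right fun hn => by rw [hn]

theorem descends_nil : Descends m 0 [] := by simp [Descends]

theorem descends_cons_true : Descends m k (true :: w) ↔ k ≤ 0 ∧ Descends m (k - m) w := by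
  simp only [Descends, level_cons_true, above_cons_true]
  grind

theorem descends_cons_false : Descends m k (false :: w) ↔ Descends m (k + 1) w := by
  simp only [Descends, level_cons_false, above_cons_false]
  have hk (h : Above m (k + 1) w) : k ≤ 0 := by have := h.nonpos; omega
  grind

theorem Descends.append (hu : Descends m k u) (hv : Descends m 0 v) : Descends m k (u ++ v) := by
  simpa [Descends, hu.1, hv.1] using And.intro hu.2 hv.2

theorem Descends.of_append_left (h : Descends m k (u ++ v)) (hv : level m v = 0) :
    Descends m k u := by
  simpa [Descends, hv] using And.intro h.1 (above_append.1 h.2).1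

theorem Descends.of_append_right (h : Descends m k (u ++ v)) (hv : level m v = 0) :
    Descends m 0 v := by
  simpa [Descends, hv, (h.of_append_left hv).1] using (above_append.1 h.2).2

theorem Descends.append_false (h : Descends m k u) : Descends m (k - 1) (u ++ [false]) := by
  have := h.2.nonpos
  simpa [Descends, h.1, ← sub_eq_add_neg] using h.2.mono (sub_one_lt k).le

theorem Descends.level_drop_nonpos (h : Descends m k w) (i : ℕ) : level m (w.drop i) ≤ 0 := by
  have := h.2 _ (w.take_prefix i)
  have := level_take_add_level_drop (m := m) w i
  have := h.1
  omega

theorem IsPrimitive.descends {c : List Bool} (h : IsPrimitive m c) : Descends m 0 c :=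
  let ⟨⟨_, hc⟩, _⟩ := h
  (isBallot_iff.1 hc).2

/-! ## Contacts with the final level -/

/-- The number of contacts of a word with its final level, the end itself not being counted. In
terms of suffixes rather than prefixes: the number of nonempty suffixes that end at the level at
which they start. -/
def contacts (m : ℕ) (w : List Bool) : ℕ :=
  {i ∈ Finset.range w.length | level m (w.drop i) = 0}.card

@[simp] theorem contacts_nil : contacts m [] = 0 := rfl

theorem contacts_cons (a : Bool) (w : List Bool) :
    contacts m (a :: w) = contacts m w + if level m (a :: w) = 0 then 1 else 0 := by
  simp only [contacts, Finset.card_filter, List.length_cons, Finset.sum_range_succ',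
    List.drop_succ_cons, List.drop_zero]

theorem contacts_append (hv : level m v = 0) :
    contacts m (u ++ v) = contacts m u + contacts m v := by
  induction u with
  | nil => simp
  | cons a u ih =>
    have hlevel : level m (a :: (u ++ v)) = level m (a :: u) := by
      rw [← List.cons_append, level_append, hv, add_zero]
    rw [List.cons_append, contacts_cons, contacts_cons, ih, hlevel]
    ring

theorem contacts_append_false (hu : Descends m k u) : contacts m (u ++ [false]) = 0 := by
  rw [contacts, Finset.card_eq_zero, Finset.filter_eq_empty_iff]
  intro i hi
  have hi : i ≤ u.length := by simpa [Nat.lt_succ_iff] using hi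
  have := hu.level_drop_nonpos i
  rw [List.drop_append_of_le_length hi, level_append, level_cons_false, level_nil]
  omega

theorem contacts_append_cons_false (hu : Descends m k u) (hv : level m v = 0) :
    contacts m (u ++ false :: v) = contacts m v := by
  rw [List.append_cons, contacts_append hv, contacts_append_false hu, zero_add]

theorem sum_contacts_drop {M : Type*} [AddCommMonoid M] (f : ℕ → M) (w : List Bool) :
    ∑ i ∈ Finset.range (w.length + 1) with level m (w.drop i) = 0, f (contacts m (w.drop i)) =
      ∑ r ∈ Finset.range (contacts m w + 1), f r := by
  rw [Finset.sum_filter]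
  induction w with
  | nil => simp
  | cons a w ih =>
    rw [List.length_cons, Finset.sum_range_succ']
    simp only [List.drop_succ_cons, List.drop_zero, ih, contacts_cons]
    split_ifs
    · rw [← Finset.sum_range_succ]
    · rw [add_zero, add_zero]

theorem BallotPath.returns_eq_contacts (D : BallotPath m n) : D.returns = contacts m D.1 := by
  obtain ⟨w, hw⟩ := D
  have hlevel : level m w = 0 := (isBallot_iff.1 hw).2.1
  have hdrop (i : ℕ) : level m (w.drop i) = 0 ↔ level m (w.take i) = 0 := by
    have := level_take_add_level_drop (m := m) w i
    omega
  let onAxis (i : ℕ) : ℕ := if level m (w.take i) = 0 then 1 else 0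
  have hshift : ∑ i ∈ Finset.range w.length, onAxis (i + 1) =
      ∑ i ∈ Finset.range w.length, onAxis i := by
    have h := (Finset.sum_range_succ' onAxis w.length).symm.trans
      (Finset.sum_range_succ onAxis w.length)
    simpa [onAxis, hlevel] using h
  simp only [returns, contacts, Finset.card_filter, hdrop, ← level_eq_zero_iff]
  rw [← hshift, Finset.range_eq_Ico, Finset.sum_Ico_add']
  rfl

/-! ## Rotations of words -/

/-- The word `v` is obtained from `u` by a rotation: `Rotation` for words that need not be ballot
words, so that it can be studied on factors of ballot words. -/
def WordRotation (m : ℕ) (u v : List Bool) : Prop :=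
  ∃ a c b : List Bool, IsPrimitive m c ∧ u = a ++ false :: (c ++ b) ∧ v = a ++ (c ++ false :: b)

/-- The word `v` is obtained from `u` by a sequence of rotations. -/
def WordLE (m : ℕ) : List Bool → List Bool → Prop := Relation.ReflTransGen (WordRotation m)

namespace WordRotation

theorem append_left (h : WordRotation m u v) (w : List Bool) :
    WordRotation m (w ++ u) (w ++ v) := by
  obtain ⟨a, c, b, hc, rfl, rfl⟩ := h
  exact ⟨w ++ a, c, b, hc, by simp, by simp⟩

theorem append_right (h : WordRotation m u v) (w : List Bool) :
    WordRotation m (u ++ w) (v ++ w) := by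
  obtain ⟨a, c, b, hc, rfl, rfl⟩ := h
  exact ⟨a, c, b ++ w, hc, by simp, by simp⟩

theorem perm (h : WordRotation m u v) : u.Perm v := by
  obtain ⟨a, c, b, -, rfl, rfl⟩ := h
  exact List.perm_middle.symm.append_left a

theorem above_iff (h : WordRotation m u v) : Above m k u ↔ Above m k v := by
  obtain ⟨a, c, b, hc, rfl, rfl⟩ := h
  have hc := hc.descends
  simp only [above_append, above_cons_false, hc.1, sub_zero]
  constructor
  · rintro ⟨ha, ha', hc', hb⟩
    exact ⟨ha, hc'.mono (by omega), ha', hb⟩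
  · rintro ⟨ha, -, ha', hb⟩
    have := hb.nonpos
    exact ⟨ha, ha', hc.2.mono (by omega), hb⟩

theorem descends_iff (h : WordRotation m u v) : Descends m k u ↔ Descends m k v := by
  rw [Descends, Descends, level_eq_of_perm h.perm, h.above_iff]

-- A word staying above its starting point cannot begin inside the factor `c 0` that the rotation
-- creates, because that factor ends below each of its other points.
theorem of_append (h : WordRotation m w (u ++ v)) (hv : Above m 0 v) :
    (∃ u', w = u' ++ v ∧ WordRotation m u' u) ∨ ∃ v', w = u ++ v' ∧ WordRotation m v' v := by
  obtain ⟨a, c, b, hc, rfl, e⟩ := h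
  rcases List.append_eq_append_iff.1 e with ⟨a', rfl, rfl⟩ | ⟨r, rfl, hr⟩
  · exact .inr ⟨_, List.append_assoc .., a', c, b, hc, rfl, rfl⟩
  rcases List.append_eq_append_iff.1 hr with ⟨d, rfl, hd⟩ | ⟨d, rfl, rfl⟩
  · cases d with
    | nil =>
      obtain rfl : v = false :: b := hd.symm
      exact absurd (above_cons_false.1 hv).2.nonpos (by simp)
    | cons x d =>
      obtain ⟨rfl, rfl⟩ := List.cons.inj hd
      exact .inl ⟨a ++ false :: (c ++ d), by simp, a, c, d, hc, rfl, by simp⟩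
  · have hlevel := hc.descends.1
    have hr_nonneg := (above_append.1 hc.descends.2).1.le_level
    have hd_pos := (above_cons_false.1 (above_append.1 hv).2).2.nonpos
    rw [level_append] at hlevel
    omega

theorem of_append_false (h : WordRotation m w (u ++ [false])) :
    (∃ u', w = u' ++ [false] ∧ WordRotation m u' u) ∨
      ∃ a c, IsPrimitive m c ∧ u = a ++ c ∧ w = a ++ false :: c := by
  obtain ⟨a, c, b, hc, rfl, e⟩ := h
  rcases List.eq_nil_or_concat b with rfl | ⟨b, x, rfl⟩
  · rw [← List.append_assoc] at e
    exact .inr ⟨a, c, hc, List.append_cancel_right e, by simp⟩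
  · have e : u ++ [false] = (a ++ (c ++ false :: b)) ++ [x] := by simpa using e
    obtain ⟨rfl, hx⟩ := List.append_inj' e rfl
    obtain rfl : false = x := by simpa using hx
    exact .inl ⟨a ++ false :: (c ++ b), by simp, a, c, b, hc, rfl, rfl⟩

theorem of_cons_true (h : WordRotation m w (true :: u)) (hu : Above m 0 (true :: u)) :
    ∃ u', w = true :: u' ∧ WordRotation m u' u := by
  have hw := h.above_iff.2 hu
  obtain ⟨a, c, b, hc, rfl, e⟩ := h
  cases a with
  | nil => exact absurd (above_cons_false.1 hw).2.nonpos (by simp)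
  | cons x a =>
    obtain ⟨rfl, rfl⟩ := List.cons.inj e
    exact ⟨_, rfl, a, c, b, hc, rfl, rfl⟩

end WordRotation

namespace WordLE

theorem append_left (h : WordLE m u v) (w : List Bool) : WordLE m (w ++ u) (w ++ v) :=
  Relation.ReflTransGen.lift (w ++ ·) (fun _ _ h => h.append_left w) _ _ h

theorem append_right (h : WordLE m u v) (w : List Bool) : WordLE m (u ++ w) (v ++ w) :=
  Relation.ReflTransGen.lift (· ++ w) (fun _ _ h => h.append_right w) _ _ h

theorem append {u' v' : List Bool} (hu : WordLE m u u') (hv : WordLE m v v') :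
    WordLE m (u ++ v) (u' ++ v') :=
  (hu.append_right v).trans (hv.append_left u')

theorem perm (h : WordLE m u v) : u.Perm v := by
  induction h with
  | refl => rfl
  | tail _ h ih => exact ih.trans h.perm

theorem above_iff (h : WordLE m u v) : Above m k u ↔ Above m k v := by
  induction h with
  | refl => rfl
  | tail _ h ih => exact ih.trans h.above_iff

theorem descends_iff (h : WordLE m u v) : Descends m k u ↔ Descends m k v := by
  rw [Descends, Descends, level_eq_of_perm h.perm, h.above_iff]

theorem isBallot_iff (h : WordLE m u v) : IsBallot m n u ↔ IsBallot m n v := by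
  rw [MTamari.isBallot_iff, MTamari.isBallot_iff, h.perm.count_eq, h.descends_iff]

end WordLE

theorem BallotPath.le_iff_wordLE {D E : BallotPath m n} : D ≤ E ↔ WordLE m D.1 E.1 := by
  refine ⟨fun h => Relation.ReflTransGen.lift Subtype.val (fun _ _ h => h) _ _ h, ?_⟩
  obtain ⟨u, hu⟩ := D
  obtain ⟨v, hv⟩ := E
  intro h
  change WordLE m u v at h
  induction h using Relation.ReflTransGen.head_induction_on with
  | refl => exact le_rfl
  | @head u w hrot hle ih =>
    have hw : IsBallot m n w := (WordLE.isBallot_iff hle).2 hv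
    exact Relation.ReflTransGen.head (b := (⟨w, hw⟩ : BallotPath m n)) hrot (ih hw)

/-! ## Words of trees -/

/-- The word `D_{R_j} 0 … D_{R_1} 0` of a list `R_1, …, R_j` of trees. -/
def chainWord (L : List (Tree m)) : List Bool :=
  (L.map fun T => T.word ++ [false]).reverse.flatten

@[simp] theorem chainWord_nil : chainWord ([] : List (Tree m)) = [] := rfl

@[simp] theorem chainWord_cons (T : Tree m) (L : List (Tree m)) :
    chainWord (T :: L) = chainWord L ++ T.word ++ [false] := by
  simp [chainWord]

@[simp] theorem chainWord_append (L L' : List (Tree m)) :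
    chainWord (L ++ L') = chainWord L' ++ chainWord L := by
  simp [chainWord]

theorem Tree.word_node_eq_chainWord (f : Fin (m + 1) → Tree m) :
    (node f).word = (f 0).word ++ true :: chainWord (List.ofFn fun i : Fin m => f i.succ) := by
  rw [word, chainWord, List.map_ofFn]
  rfl

theorem Tree.descends_word (T : Tree m) : Descends m 0 T.word :=
  (isBallot_iff.1 (SizedTree.toPath ⟨T, rfl⟩).2).2

theorem descends_chainWord_append (L : List (Tree m)) (T : Tree m) :
    Descends m (-L.length) (chainWord L ++ T.word) := by
  induction L generalizing T with
  | nil => simpa using T.descends_word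
  | cons S L ih =>
    have h := (ih S).append_false.append T.descends_word
    rwa [← neg_add', ← Nat.cast_succ, ← chainWord_cons] at h

theorem descends_chainWord (L : List (Tree m)) : Descends m (-L.length) (chainWord L) := by
  simpa [Tree.word] using descends_chainWord_append L .empty

theorem contacts_chainWord (L : List (Tree m)) : contacts m (chainWord L) = 0 := by
  cases L with
  | nil => rfl
  | cons T L =>
    rw [chainWord_cons]
    exact contacts_append_false (descends_chainWord_append L T)

theorem lt_level_of_prefix_chainWord {L : List (Tree m)} {p : List Bool}
    (hp : p <+: chainWord L) (hne : p ≠ chainWord L) : -(L.length : ℤ) < level m p := by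
  cases L with
  | nil => exact absurd (List.prefix_nil.1 hp) hne
  | cons T L =>
    rw [chainWord_cons] at hp hne
    have := (descends_chainWord_append L T).2 p
      ((List.prefix_concat_iff.1 hp).resolve_left hne)
    push_cast [List.length_cons]
    omega

theorem descends_cons_true_chainWord {L : List (Tree m)} (hL : L.length = m) :
    Descends m 0 (true :: chainWord L) :=
  descends_cons_true.2 ⟨le_rfl, by simpa [hL] using descends_chainWord L⟩

theorem isPrimitive_cons_true_chainWord {L : List (Tree m)} (hL : L.length = m) :
    IsPrimitive m (true :: chainWord L) := by
  refine ⟨⟨_, isBallot_iff.2 ⟨rfl, descends_cons_true_chainWord hL⟩⟩, by simp,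
    fun p hp hnil hne => ?_⟩
  obtain ⟨q, rfl, hq⟩ := (List.prefix_cons_iff.1 hp).resolve_left hnil
  have := lt_level_of_prefix_chainWord hq fun h => hne (h ▸ rfl)
  rw [Ne, ← level_eq_zero_iff, level_cons_true]
  omega

theorem Tree.contacts_word (T : Tree m) : contacts m T.word = T.leftBranch := by
  induction T with
  | empty => rfl
  | node f ih =>
    have hd : Descends m 0 (true :: chainWord (List.ofFn fun i : Fin m => f i.succ)) :=
      descends_cons_true_chainWord List.length_ofFn
    rw [word_node_eq_chainWord, contacts_append hd.1, contacts_cons, if_pos hd.1,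
      contacts_chainWord, ih, leftBranch]
    ring

/-! ## Every ballot word is the word of a tree -/

theorem Tree.exists_word_eq_cons_true {L : List (Tree m)} (hL : L.length = m) :
    ∃ T : Tree m, T.word = true :: chainWord L := by
  have hofFn : List.ofFn (fun i : Fin m => L.get (i.cast hL.symm)) = L := by
    rw [← List.ofFn_congr hL, List.ofFn_get]
  refine ⟨node (Fin.cons empty fun i => L.get (i.cast hL.symm)), ?_⟩
  rw [word_node_eq_chainWord]
  simp only [Fin.cons_zero, Fin.cons_succ, hofFn, word, List.nil_append]

theorem Tree.exists_word_eq_append (S T : Tree m) : ∃ R : Tree m, R.word = S.word ++ T.word := by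
  induction T with
  | empty => exact ⟨S, by simp [word]⟩
  | node f ih =>
    obtain ⟨R, hR⟩ := ih 0
    exact ⟨node (Fin.cons R (Fin.tail f)), by simp [word_node_eq_chainWord, hR, Fin.tail]⟩

theorem exists_chainWord_append_eq_append (S : Tree m) (L : List (Tree m)) (T : Tree m) :
    ∃ (L' : List (Tree m)) (T' : Tree m), L'.length = L.length ∧
      S.word ++ (chainWord L ++ T.word) = chainWord L' ++ T'.word := by
  rcases List.eq_nil_or_concat L with rfl | ⟨L, R, rfl⟩
  · obtain ⟨T', hT'⟩ := S.exists_word_eq_append T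
    exact ⟨[], T', rfl, by simp [hT']⟩
  · obtain ⟨R', hR'⟩ := S.exists_word_eq_append R
    exact ⟨L ++ [R'], T, by simp, by simp [hR']⟩

theorem Descends.exists_chainWord_append {j : ℕ} (h : Descends m (-j) w) :
    ∃ (L : List (Tree m)) (T : Tree m), L.length = j ∧ w = chainWord L ++ T.word := by
  induction w generalizing j with
  | nil =>
    obtain rfl : j = 0 := by simpa using h.1.symm
    exact ⟨[], .empty, rfl, rfl⟩
  | cons a w ih =>
    cases a with
    | false =>
      have h := descends_cons_false.1 h
      have := h.2.nonpos
      obtain ⟨j, rfl⟩ := Nat.exists_eq_succ_of_ne_zero (n := j) (by omega)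
      obtain ⟨L, T, rfl, rfl⟩ := ih (j := j) (by simpa using h)
      exact ⟨L ++ [.empty], T, by simp, by simp [Tree.word]⟩
    | true =>
      obtain ⟨L, T, hL, rfl⟩ := ih (j := j + m) <| by
        simpa [sub_eq_add_neg, add_comm] using (descends_cons_true.1 h).2
      obtain ⟨S, hS⟩ := Tree.exists_word_eq_cons_true (L := L.drop j) (by simp [hL])
      obtain ⟨L', T', hL', e⟩ := exists_chainWord_append_eq_append S (L.take j) T
      refine ⟨L', T', by simp [hL', hL], ?_⟩
      rw [← e, hS, List.cons_append, ← List.append_assoc, ← chainWord_append,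
        List.take_append_drop]

theorem Descends.exists_tree (h : Descends m 0 w) : ∃ T : Tree m, T.word = w := by
  obtain ⟨L, T, hL, rfl⟩ := h.exists_chainWord_append (j := 0)
  obtain rfl := List.length_eq_zero_iff.1 hL
  exact ⟨T, rfl⟩

/-! ## The words below a given word -/

theorem Tree.wordLE_cons_false_word (T : Tree m) :
    WordLE m (false :: T.word) (T.word ++ [false]) := by
  induction T with
  | empty => exact .refl
  | node f ih =>
    let c := true :: chainWord (List.ofFn fun i : Fin m => f i.succ)
    have hc : IsPrimitive m c := isPrimitive_cons_true_chainWord List.length_ofFn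
    rw [word_node_eq_chainWord]
    exact ((ih 0).append_right c).tail ⟨(f 0).word, c, [], hc, by simp, by simp [c]⟩

theorem wordLE_append_iff (hv : Above m 0 v) :
    WordLE m w (u ++ v) ↔ ∃ u' v', w = u' ++ v' ∧ WordLE m u' u ∧ WordLE m v' v := by
  constructor
  · intro h
    induction h using Relation.ReflTransGen.head_induction_on with
    | refl => exact ⟨u, v, rfl, .refl, .refl⟩
    | head hrot _ ih =>
      obtain ⟨u', v', rfl, hu', hv'⟩ := ih
      rcases hrot.of_append (hv'.above_iff.2 hv) with ⟨u'', rfl, hu''⟩ | ⟨v'', rfl, hv''⟩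
      · exact ⟨u'', v', rfl, .head hu'' hu', hv'⟩
      · exact ⟨u', v'', rfl, hu', .head hv'' hv'⟩
  · rintro ⟨u', v', rfl, hu', hv'⟩
    exact hu'.append hv'

theorem wordLE_cons_true_iff (hu : Above m 0 (true :: u)) :
    WordLE m w (true :: u) ↔ ∃ u', w = true :: u' ∧ WordLE m u' u := by
  constructor
  · intro h
    induction h using Relation.ReflTransGen.head_induction_on with
    | refl => exact ⟨u, rfl, .refl⟩
    | head hrot hle ih =>
      obtain ⟨u', rfl, hu'⟩ := ih
      obtain ⟨u'', rfl, hrot'⟩ := hrot.of_cons_true ((WordLE.above_iff hle).2 hu)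
      exact ⟨u'', rfl, .head hrot' hu'⟩
  · rintro ⟨u', rfl, hu'⟩
    exact hu'.append_left [true]

-- Undoing a rotation either acts within `s` or within `v`, or moves the distinguished down step to
-- the left across a primitive factor, which then joins `v`.
theorem WordRotation.exists_of_append_cons_false {s : List Bool}
    (h : WordRotation m w (s ++ false :: v)) (hv : Descends m 0 v) :
    ∃ s' v', w = s' ++ false :: v' ∧ Descends m 0 v' ∧ WordLE m (s' ++ v') (s ++ v) := by
  rw [List.append_cons] at h
  rcases h.of_append hv.2 with ⟨w', rfl, hw'⟩ | ⟨v', rfl, hv'⟩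
  · rcases hw'.of_append_false with ⟨s', rfl, hs'⟩ | ⟨a, c, hc, rfl, rfl⟩
    · exact ⟨s', v, by simp, hv, .single (hs'.append_right v)⟩
    · exact ⟨a, c ++ v, by simp, hc.descends.append hv, by rw [List.append_assoc]; exact .refl⟩
  · exact ⟨s, v', by simp, hv'.descends_iff.2 hv, .single (hv'.append_left s)⟩

theorem wordLE_append_false_iff :
    WordLE m w (u ++ [false]) ↔
      ∃ s v, w = s ++ false :: v ∧ Descends m 0 v ∧ WordLE m (s ++ v) u := by
  constructor
  · intro h
    induction h using Relation.ReflTransGen.head_induction_on with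
    | refl => exact ⟨u, [], rfl, descends_nil, by rw [List.append_nil]; exact .refl⟩
    | head hrot _ ih =>
      obtain ⟨s, v, rfl, hv, hle⟩ := ih
      obtain ⟨s', v', rfl, hv', hle'⟩ := hrot.exists_of_append_cons_false hv
      exact ⟨s', v', rfl, hv', hle'.trans hle⟩
  · rintro ⟨s, v, rfl, hv, hle⟩
    obtain ⟨T, rfl⟩ := hv.exists_tree
    have h : WordLE m (s ++ false :: T.word) (s ++ T.word ++ [false]) := by
      rw [List.append_assoc]
      exact T.wordLE_cons_false_word.append_left s
    exact h.trans (hle.append_right [false])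

theorem finite_setOf_wordLE (m : ℕ) (u : List Bool) : {w | WordLE m w u}.Finite :=
  (List.finite_length_eq Bool u.length).subset fun _ hw => hw.perm.length_eq

/-- The finite set of the words below `u`. -/
noncomputable def lower (m : ℕ) (u : List Bool) : Finset (List Bool) :=
  (finite_setOf_wordLE m u).toFinset

@[simp] theorem mem_lower : w ∈ lower m u ↔ WordLE m w u := by simp [lower]

theorem lower_nil : lower m [] = {[]} := by
  ext w
  rw [mem_lower, Finset.mem_singleton]
  exact ⟨fun h => h.perm.eq_nil, by rintro rfl; exact .refl⟩

theorem lower_append (hv : Above m 0 v) :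
    lower m (u ++ v) = (lower m u ×ˢ lower m v).image fun p => p.1 ++ p.2 := by
  ext w
  simp only [mem_lower, wordLE_append_iff hv, Finset.mem_image, Finset.mem_product, Prod.exists]
  grind

theorem lower_cons_true (hu : Above m 0 (true :: u)) :
    lower m (true :: u) = (lower m u).image (true :: ·) := by
  ext w
  simp only [mem_lower, wordLE_cons_true_iff hu, Finset.mem_image]
  grind

theorem mem_lower_append_false (hu : Descends m k u) :
    w ∈ lower m (u ++ [false]) ↔
      ∃ w' ∈ lower m u, ∃ i ≤ w'.length, level m (w'.drop i) = 0 ∧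
        w'.take i ++ false :: w'.drop i = w := by
  simp only [mem_lower, wordLE_append_false_iff]
  constructor
  · rintro ⟨s, v, rfl, hv, hle⟩
    exact ⟨s ++ v, hle, s.length, by simp, by simpa using hv.1, by simp⟩
  · rintro ⟨w', hle, i, -, hlevel, rfl⟩
    have hw' : Descends m k (w'.take i ++ w'.drop i) := by
      simpa using hle.descends_iff.2 hu
    exact ⟨_, _, rfl, hw'.of_append_right hlevel, by simpa using hle⟩

/-! ## The generating polynomials of the lower sets -/

/-- The polynomial counting the words below `u` according to their number of contacts. -/
noncomputable def lowerPoly (m : ℕ) (u : List Bool) : ℤ[X] :=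
  ∑ w ∈ lower m u, X ^ contacts m w

theorem lowerPoly_nil : lowerPoly m [] = 1 := by simp [lowerPoly, lower_nil]

theorem lowerPoly_append (hv : Descends m 0 v) :
    lowerPoly m (u ++ v) = lowerPoly m u * lowerPoly m v := by
  rw [lowerPoly, lower_append hv.2, Finset.sum_image, Finset.sum_product, lowerPoly, lowerPoly,
    Finset.sum_mul_sum]
  · refine Finset.sum_congr rfl fun u' _ => Finset.sum_congr rfl fun v' hv' => ?_
    rw [contacts_append ((mem_lower.1 hv').descends_iff.2 hv).1, pow_add]
  · rintro ⟨u₁, v₁⟩ h₁ ⟨u₂, v₂⟩ h₂ e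
    simp only [Finset.coe_product, Set.mem_prod, Finset.mem_coe, mem_lower] at h₁ h₂
    have hlength : u₁.length = u₂.length := h₁.1.perm.length_eq.trans h₂.1.perm.length_eq.symm
    exact Prod.ext_iff.2 (List.append_inj e hlength)

theorem lowerPoly_cons_true (hu : Descends m 0 (true :: u)) :
    lowerPoly m (true :: u) = X * lowerPoly m u := by
  rw [lowerPoly, lower_cons_true hu.2, Finset.sum_image (by simp), lowerPoly, Finset.mul_sum]
  refine Finset.sum_congr rfl fun u' hu' => ?_
  have hlevel : level m (true :: u') = 0 :=
    (level_eq_of_perm ((mem_lower.1 hu').perm.cons true)).trans hu.1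
  rw [contacts_cons, if_pos hlevel, pow_succ']

theorem Descends.prefix_of_append_cons_false {s s' t t' : List Bool} (hs : level m s = k)
    (hs' : Descends m k s') (e : s ++ false :: t = s' ++ false :: t') : s' <+: s := by
  rcases List.append_eq_append_iff.1 e with ⟨r, rfl, hr⟩ | ⟨r, rfl, -⟩
  · cases r with
    | nil => simp
    | cons x r =>
      obtain rfl : false = x := (List.cons.inj hr).1
      have := (above_cons_false.1 (above_append.1 hs'.2).2).2.nonpos
      omega
  · exact List.prefix_append _ _

theorem Descends.append_cons_false_inj {s s' t t' : List Bool} (hs : Descends m k s)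
    (hs' : Descends m k s') (e : s ++ false :: t = s' ++ false :: t') : s = s' ∧ t = t' := by
  obtain rfl : s = s' := (prefix_of_append_cons_false hs'.1 hs e.symm).eq_of_length_le
    (prefix_of_append_cons_false hs.1 hs' e).length_le
  exact ⟨rfl, by simpa using e⟩

theorem Descends.take (h : Descends m k w) {i : ℕ} (hi : level m (w.drop i) = 0) :
    Descends m k (w.take i) :=
  of_append_left (v := w.drop i) (by rwa [List.take_append_drop]) hi

theorem Descends.insert_false_inj {i j : ℕ} (hu : Descends m k u) (hv : Descends m k v)
    (hi : level m (u.drop i) = 0) (hj : level m (v.drop j) = 0)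
    (hil : i ≤ u.length) (hjl : j ≤ v.length)
    (e : u.take i ++ false :: u.drop i = v.take j ++ false :: v.drop j) : u = v ∧ i = j := by
  obtain ⟨htake, hdrop⟩ := (hu.take hi).append_cons_false_inj (hv.take hj) e
  refine ⟨?_, by simpa [hil, hjl] using congrArg List.length htake⟩
  rw [← List.take_append_drop i u, htake, hdrop, List.take_append_drop]

theorem lowerPoly_append_false (hu : Descends m k u) :
    lowerPoly m (u ++ [false]) =
      ∑ w ∈ lower m u, ∑ r ∈ Finset.range (contacts m w + 1), X ^ r := by
  have hdesc {w : List Bool} (hw : w ∈ lower m u) : Descends m k w :=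
    (mem_lower.1 hw).descends_iff.2 hu
  simp only [← sum_contacts_drop]
  rw [Finset.sum_sigma', lowerPoly]
  symm
  refine Finset.sum_bij (fun p _ => p.1.take p.2 ++ false :: p.1.drop p.2) ?_ ?_ ?_ ?_ <;>
    simp only [Sigma.forall, Finset.mem_sigma, Finset.mem_filter, Finset.mem_range,
      Nat.lt_succ_iff, and_imp]
  · intro w i hw hi hlevel
    exact (mem_lower_append_false hu).2 ⟨w, hw, i, hi, hlevel, rfl⟩
  · intro w i hw hi hlevel w' i' hw' hi' hlevel' e
    obtain ⟨rfl, rfl⟩ := (hdesc hw).insert_false_inj (hdesc hw') hlevel hlevel' hi hi' e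
    rfl
  · intro w hw
    obtain ⟨w', hw', i, hi, hlevel, rfl⟩ := (mem_lower_append_false hu).1 hw
    exact ⟨⟨w', i⟩, by simp [mem_lower.1 hw', hi, hlevel], rfl⟩
  · intro w i hw _ hlevel
    rw [contacts_append_cons_false ((hdesc hw).take hlevel) hlevel]

theorem X_sub_one_mul_lowerPoly_append_false (hu : Descends m k u) :
    (X - 1) * lowerPoly m (u ++ [false]) =
      X * lowerPoly m u - C ((lowerPoly m u).eval 1) := by
  rw [lowerPoly_append_false hu, lowerPoly, Finset.mul_sum, Finset.mul_sum, eval_finsetSum]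
  simp [mul_geom_sum, pow_succ']

theorem X_sub_one_mul_atYOne_Δ (g : ℤ[X][X]) :
    (X - 1) * atYOne (Δ g) = X * atYOne g - C ((atYOne g).eval 1) := by
  have heval : (atYOne g).eval 1 = (g.eval 1).eval 1 := eval_one_map (evalRingHom 1) g
  simpa [atYOne, heval] using congrArg atYOne (Δ_spec g)

theorem atYOne_toXY (p : ℤ[X]) : atYOne (toXY p) = p := by
  have h : (evalRingHom (1 : ℤ)).comp C = RingHom.id ℤ := RingHom.ext fun _ => eval_C
  rw [atYOne, toXY, coe_mapRingHom, coe_mapRingHom, map_map, h, map_id]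

theorem lowerPoly_chainWord (L : List (Tree m)) (hL : ∀ T ∈ L, T.poly = lowerPoly m T.word) :
    lowerPoly m (chainWord L) =
      atYOne ((L.map fun T => toXY T.poly).foldr (fun g acc => Δ (g * acc)) 1) := by
  induction L with
  | nil => simp [lowerPoly_nil]
  | cons T L ih =>
    obtain ⟨hT, hL⟩ := List.forall_mem_cons.1 hL
    have hne : (X - 1 : ℤ[X]) ≠ 0 := X_sub_C_ne_zero 1
    refine mul_left_cancel₀ hne ?_
    rw [chainWord_cons, X_sub_one_mul_lowerPoly_append_false (descends_chainWord_append L T),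
      lowerPoly_append T.descends_word, ← hT, ih hL, List.map_cons, List.foldr_cons,
      X_sub_one_mul_atYOne_Δ, map_mul, atYOne_toXY, mul_comm T.poly]

theorem Tree.poly_eq_lowerPoly (T : Tree m) : T.poly = lowerPoly m T.word := by
  induction T with
  | empty => exact lowerPoly_nil.symm
  | node f ih =>
    have hd : Descends m 0 (true :: chainWord (List.ofFn fun i : Fin m => f i.succ)) :=
      descends_cons_true_chainWord List.length_ofFn
    have hrights : ∀ T ∈ List.ofFn (fun i : Fin m => f i.succ), T.poly = lowerPoly m T.word :=
      List.forall_mem_ofFn_iff.2 fun i => ih i.succ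
    have hXY : atYOne (X * C X) = X := by simp [atYOne]
    rw [word_node_eq_chainWord, lowerPoly_append hd, lowerPoly_cons_true hd, ← ih 0,
      lowerPoly_chainWord _ hrights, poly, B, mul_assoc _ X, map_mul, map_mul, hXY, atYOne_toXY,
      List.map_ofFn, mul_assoc]
    rfl

/-! ## Sums over ballot paths and over trees -/

namespace SizedTree

theorem toPath_surjective : Function.Surjective (toPath (m := m) (n := n)) := by
  rintro ⟨w, hw⟩
  obtain ⟨T, rfl⟩ := (isBallot_iff.1 hw).2.exists_tree
  exact ⟨⟨T, T.word_count_true.symm.trans hw.1⟩, rfl⟩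

theorem returns_toPath (T : SizedTree m n) : T.toPath.returns = T.1.leftBranch :=
  T.toPath.returns_eq_contacts.trans T.1.contacts_word

theorem poly_eq_sum_paths (T : SizedTree m n) :
    T.1.poly = ∑ D : BallotPath m n with D ≤ T.toPath, X ^ D.returns := by
  rw [Tree.poly_eq_lowerPoly, lowerPoly]
  symm
  refine Finset.sum_bij (fun D _ => D.1) (fun D hD => ?_) (fun _ _ _ _ => Subtype.ext)
    (fun w hw => ?_) fun D _ => by rw [D.returns_eq_contacts]
  · exact mem_lower.2 (BallotPath.le_iff_wordLE.1 (Finset.mem_filter.1 hD).2)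
  · have hle : WordLE m w T.toPath.1 := mem_lower.1 hw
    let D : BallotPath m n := ⟨w, hle.isBallot_iff.2 T.toPath.2⟩
    exact ⟨D, Finset.mem_filter.2 ⟨Finset.mem_univ _, BallotPath.le_iff_wordLE.2 hle⟩, rfl⟩

theorem poly_eq_sum_trees (T : SizedTree m n) :
    T.1.poly = ∑ T' : SizedTree m n with T' ≤ T, X ^ T'.1.leftBranch := by
  rw [T.poly_eq_sum_paths, Finset.sum_filter, Finset.sum_filter]
  symm
  refine Fintype.sum_bijective toPath ⟨toPath_injective, toPath_surjective⟩ _ _ fun T' => ?_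
  rw [returns_toPath]
  exact if_congr Iff.rfl rfl rfl

end SizedTree

end MTamari

theorem mainTheorem5 (m n : ℕ) (hm : 1 ≤ m) (T : MTamari.SizedTree m n) :
    (T.1.poly = ∑ T' : MTamari.SizedTree m n with T' ≤ T, Polynomial.X ^ T'.1.leftBranch) ∧
    (T.1.poly = ∑ D : MTamari.BallotPath m n with D ≤ T.toPath, Polynomial.X ^ D.returns) ∧
    (∀ T' : MTamari.SizedTree m n, T'.toPath.returns = T'.1.leftBranch) ∧
    T.1.poly.eval 1 = ((Finset.univ.filter fun T' : MTamari.SizedTree m n => T' ≤ T).card : ℤ) ∧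
    T.1.poly.eval 1 =
      ((Finset.univ.filter fun D : MTamari.BallotPath m n => D ≤ T.toPath).card : ℤ) := by
  refine ⟨T.poly_eq_sum_trees, T.poly_eq_sum_paths, MTamari.SizedTree.returns_toPath, ?_, ?_⟩
  · simp [T.poly_eq_sum_trees, eval_finsetSum]
  · simp [T.poly_eq_sum_paths, eval_finsetSum]
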